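/- Let $R$ be a ring (associative, with unit, not necessarily commutative), write $[x,y]=xy-yx$, and let $n,m\ge 0$ be integers. For an $n\times n$ matrix $M$ over a ring put $$\operatorname{col-det} M=\sum_{\sigma\in S_n}\operatorname{sgn}(\sigma)\,M_{\sigma(1)1}M_{\sigma(2)2}\cdots M_{\sigma(n)n},\qquad \operatorname{row-det} M=\sum_{\sigma\in S_n}\operatorname{sgn}(\sigma)\,M_{1\sigma(1)}M_{2\sigma(2)}\cdots M_{n\sigma(n)}.$$ A matrix $M$ is *column-pseudo-commutative* if $[M_{ij},M_{k\ell}]=[M_{i\ell},M_{kj}]$ and $[M_{ij},M_{i\ell}]=0$ for all indices, and *row-pseudo-commutative* (a Manin matrix) if its transpose is column-pseudo-commutative. For $L\subseteq[m]$ with $|L|=n$, $X_{[n],L}$ (resp. $Y_{L,[n]}$) is the $n\times n$ submatrix with columns (resp. rows) indexed by $L$, in increasing order. *Oscillator.* States are combinations $\sum_{k\ge0} f_k|k\rangle$ with coefficients $f_k\in R$. The operators $a,a^\dagger$ act by $a|k\rangle=k|k-1\rangle$ (so $a|0\rangle=0$) and $a^\dagger|k\rangle=|k+1\rangle$, so that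 $[a,a^\dagger]=1$; elements of $R$ act by left multiplication on the coefficients and commute with $a$ and $a^\dagger$. For an operator $T$, $\langle0|T|0\rangle\in R$ is the coefficient of $|0\rangle$ in $T|0\rangle$. In expressions containing $(1-a^\dagger B)^{-1}$ the states are formal infinite combinations; in expressions containing $(1-aB)^{-1}$ they are finite combinations. On these spaces the matrices $1-a^\dagger B$, respectively $1-aB$, are invertible over the ring of additive operators. **Proposition.** Let $X$ be an $n\times m$ matrix and $Y$ an $m\times n$ matrix with elements in $R$, and suppose that $$[X_{ij},Y_{k\ell}]=-A_{i\ell}B_{kj}\qquad\text{for all } i,j,k,\ell,$$ with $A$ an $n\times n$ matrix over $R$ and $B$ an $m\times m$ matrix whose elements lie in the centre of $R$. Consider the conditions $$(\mathrm{XA})\quad [X_{ij},A_{k\ell}]-[X_{kj},A_{i\ell}]=0\ \text{ for all } i,j,k,\ell;\qquad (\mathrm{YA})\quad [Y_{ij},A_{k\ell}]-[Y_{i\ell},A_{kj}]=0\ \text{ for all } i,j,k,\ell.$$ (a) If $X$ is row-pseudo-commutative and (XA) holds, then $$\sum_{L\subseteq[m],\,|L|=n}\operatorname{col-det}X_{[n],L}\,\operatorname{col-det}Y_{L,[n]}=\langle0|\operatorname{col-det}\bigl[aA+X(1-a^\dagger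 B)^{-1}Y\bigr]|0\rangle .$$ (b) If $Y$ is column-pseudo-commutative and (YA) holds, then $$\sum_{L\subseteq[m],\,|L|=n}\operatorname{row-det}X_{[n],L}\,\operatorname{row-det}Y_{L,[n]}=\langle0|\operatorname{row-det}\bigl[a^\dagger A+X(1-aB)^{-1}Y\bigr]|0\rangle .$$ (c) In particular, suppose that $[X_{ji},X_{\ell k}]=0$ and $[Y_{ij},Y_{k\ell}]=0$ whenever $j\ne\ell$. Then the determinants $\det X_{[n],L}$ and $\det Y_{L,[n]}$ are well defined (they do not depend on the order of the factors in each term), and $$\sum_{L\subseteq[m],\,|L|=n}\det X_{[n],L}\,\det Y_{L,[n]}=\langle0|\operatorname{col-det}\bigl[aA+X(1-a^\dagger B)^{-1}Y\bigr]|0\rangle\quad\text{if (XA) holds},$$ $$\sum_{L\subseteq[m],\,|L|=n}\det X_{[n],L}\,\det Y_{L,[n]}=\langle0|\operatorname{row-det}\bigl[a^\dagger A+X(1-aB)^{-1}Y\bigr]|0\rangle\quad\text{if (YA) holds};$$ so all three expressions are equal if both (XA) and (YA) hold. -/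

import Mathlib

/-- The column-determinant of a square matrix over a ring: in each term the factors are multiplied
from left to right in increasing order of the column index. -/
def colDet {S : Type*} [Ring S] {n : ℕ} (M : Matrix (Fin n) (Fin n) S) : S :=
  ∑ σ : Equiv.Perm (Fin n),
    ((Equiv.Perm.sign σ : ℤˣ) : ℤ) • (List.ofFn fun i => M (σ i) i).prod

/-- The row-determinant of a square matrix over a ring: in each term the factors are multiplied
from left to right in increasing order of the row index. -/
def rowDet {S : Type*} [Ring S] {n : ℕ} (M : Matrix (Fin n) (Fin n) S) : S :=
  ∑ σ : Equiv.Perm (Fin n),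
    ((Equiv.Perm.sign σ : ℤˣ) : ℤ) • (List.ofFn fun i => M i (σ i)).prod

/-- `d` is the determinant of `M` irrespective of the order of the factors: for every choice of an
order `τ σ` of the factors in each of the terms `σ`, the signed sum of the products is `d`. -/
def HasDet {S : Type*} [Ring S] {n : ℕ} (M : Matrix (Fin n) (Fin n) S) (d : S) : Prop :=
  ∀ τ : Equiv.Perm (Fin n) → Equiv.Perm (Fin n),
    ∑ σ : Equiv.Perm (Fin n),
      ((Equiv.Perm.sign σ : ℤˣ) : ℤ) • (List.ofFn fun i => M (σ (τ σ i)) (τ σ i)).prod = d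

/-- Column-pseudo-commutative matrices. -/
def IsColPseudoComm {S : Type*} [Ring S] {p q : ℕ} (M : Matrix (Fin p) (Fin q) S) : Prop :=
  (∀ i j k l, ⁅M i j, M k l⁆ = ⁅M i l, M k j⁆) ∧ ∀ i j l, ⁅M i j, M i l⁆ = 0

/-- Row-pseudo-commutative matrices (Manin matrices): the transpose is
column-pseudo-commutative. -/
def IsRowPseudoComm {S : Type*} [Ring S] {p q : ℕ} (M : Matrix (Fin p) (Fin q) S) : Prop :=
  IsColPseudoComm M.transpose

/-- The subsets of `[m]` of cardinality `n`. -/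
abbrev Subsets (m n : ℕ) : Type := {L : Finset (Fin m) // L.card = n}

/-- `X_{[n],L}`: the columns of `X` with index in `L`, in increasing order. -/
def colMinor {S : Type*} {n m : ℕ} (X : Matrix (Fin n) (Fin m) S) (L : Subsets m n) :
    Matrix (Fin n) (Fin n) S :=
  X.submatrix id (L.1.orderEmbOfFin L.2)

/-- `Y_{L,[n]}`: the rows of `Y` with index in `L`, in increasing order. -/
def rowMinor {S : Type*} {n m : ℕ} (Y : Matrix (Fin m) (Fin n) S) (L : Subsets m n) :
    Matrix (Fin n) (Fin n) S :=
  Y.submatrix (L.1.orderEmbOfFin L.2) id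

/-! ### The bosonic oscillator with coefficients in a ring

States are combinations `∑ f k |k⟩` with coefficients `f k` in `R`, either finite ones (`ℕ →₀ R`)
or formal infinite ones (`ℕ → R`). The oscillator acts by `a† |k⟩ = |k+1⟩` and
`a |k⟩ = k |k-1⟩`, and `R` acts by left multiplication of the coefficients, so that `a` and `a†`
commute with `R`. The operators are the additive (that is, `ℤ`-linear) endomorphisms. Power series in `a†` act on formal states, power series in `a` act on finite
states. -/

/-- The creation operator on formal states. -/
def formalCreate (R : Type*) [Ring R] : Module.End ℤ (ℕ → R) where
  toFun f k := match k with
    | 0 => 0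
    | k + 1 => f k
  map_add' f g := by
    funext k
    cases k <;> simp
  map_smul' c f := by
    funext k
    cases k <;> simp

/-- The annihilation operator on formal states. -/
def formalAnnihilate (R : Type*) [Ring R] : Module.End ℤ (ℕ → R) where
  toFun f k := (k + 1) • f (k + 1)
  map_add' f g := by
    funext k
    simp
  map_smul' c f := by
    funext k
    simp only [Pi.smul_apply, RingHom.id_apply]
    rw [smul_comm]

/-- The creation operator on finite states. -/
noncomputable def finCreate (R : Type*) [Ring R] : Module.End ℤ (ℕ →₀ R) :=
  Finsupp.lsum ℤ fun k => Finsupp.lsingle (k + 1)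

/-- The annihilation operator on finite states (for `k = 0` the factor `k` makes it vanish). -/
noncomputable def finAnnihilate (R : Type*) [Ring R] : Module.End ℤ (ℕ →₀ R) :=
  Finsupp.lsum ℤ fun k => k • Finsupp.lsingle (k - 1)

/-- The vacuum expectation value `⟨0| T |0⟩` of an operator on formal states. -/
def formalVev {R : Type*} [Ring R] (T : Module.End ℤ (ℕ → R)) : R :=
  T (Pi.single 0 1) 0

/-- The vacuum expectation value `⟨0| T |0⟩` of an operator on finite states. -/
noncomputable def finVev {R : Type*} [Ring R] (T : Module.End ℤ (ℕ →₀ R)) : R :=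
  T (Finsupp.single 0 1) 0

/-- The matrix `1 - q B` with entries in the ring of operators on `V`. -/
def oneSub {R : Type*} [Ring R] {V : Type*} [AddCommGroup V] [Module R V] {m : ℕ}
    (q : Module.End ℤ V) (B : Matrix (Fin m) (Fin m) R) :
    Matrix (Fin m) (Fin m) (Module.End ℤ V) :=
  1 - q • B.map (Module.toModuleEnd ℤ V)

/-- The matrix `p A + X (1 - q B)⁻¹ Y` with entries in the ring of operators on `V`
(`Ring.inverse` is the two-sided inverse when there is one). -/
noncomputable def oscMatrix {R : Type*} [Ring R] {V : Type*} [AddCommGroup V] [Module R V]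
    {n m : ℕ} (p q : Module.End ℤ V) (X : Matrix (Fin n) (Fin m) R)
    (Y : Matrix (Fin m) (Fin n) R) (A : Matrix (Fin n) (Fin n) R)
    (B : Matrix (Fin m) (Fin m) R) : Matrix (Fin n) (Fin n) (Module.End ℤ V) :=
  p • A.map (Module.toModuleEnd ℤ V) +
    X.map (Module.toModuleEnd ℤ V) * Ring.inverse (oneSub q B) *
      Y.map (Module.toModuleEnd ℤ V)

/-! Attach to column `l` of a matrix the odd element `∑ i, θ i * M i l` of a Grassmann algebra whose
generators commute with the coefficients. The column-determinant is then the top coefficient of the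
ordered product of these elements (`Grassmann.berezin_prod_odd`), so no factor needs to be
reordered. Row-pseudo-commutativity of `X` says that its odd elements `φ j` anticommute and square
to zero. Condition (XA) says that they anticommute with the odd elements `α l` of `A`.

Put `C = (1 - a†B)⁻¹`, `y = C Y` and `β = C B`. Column `l` of the oscillator matrix becomes `a α l +
∑ k, φ k y l k`. Moving a `y` to the right past a `φ` creates a term `α β`. On the other hand `[a,
y] = β y`, because `[a, C] = C B C`. In the ordered product these two effects cancel: modulo the
left ideal generated by `a`, only the words with every `φ` to the left of every `y` remain
(`exists_prod_eq_normalOrder_add`).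

Take the vacuum expectation value. The left ideal vanishes since `a|0⟩ = 0`, and `y` may be replaced
by `Y` since `y - Y` is a left multiple of `a†` and `⟨0|a† = 0`. What remains is the Cauchy–Binet
expansion for a Manin matrix (`IsRowPseudoComm.sum_colDet_mul_colDet`).

The row version is the column version over the opposite ring: `X` and `Y` change places, and so do
`a` and `a†`. When entries in different rows of `X`, and in different columns of `Y`, commute, all
determinants of minors agree, which gives (c). -/

/-- The image of the word `φ (f 0) * φ (f 1) * ⋯` under the derivation that sends each letter
`φ j` to `ψ j`. -/
def wordDeriv {G : Type*} [Ring G] {ι : Type*} (φ ψ : ι → G) : (p : ℕ) → (Fin p → ι) → G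
  | 0, _ => 0
  | p + 1, f => ψ (f 0) * (List.ofFn fun l : Fin p => φ (f l.succ)).prod +
      φ (f 0) * wordDeriv φ ψ p fun l => f l.succ

theorem Fin.sum_univ_pi_succ {ι M : Type*} [Fintype ι] [AddCommMonoid M] {p : ℕ}
    (F : (Fin (p + 1) → ι) → M) :
    ∑ f, F f = ∑ j, ∑ f : Fin p → ι, F (Fin.cons j f) := by
  classical
  rw [← (Fin.consEquiv fun _ => ι).sum_comp, Fintype.sum_prod_type]
  rfl

/-! ### Normal ordering of words in anticommuting letters. -/

section Words

variable {G : Type*} [Ring G] {ι : Type*} [Fintype ι] {φ : ι → G} {β : ι → ι → G}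

/-- Commuting `c k` past the word replaces one letter `φ j` by `-α β k j`. Moving `α` to the front
and the outer `φ k` into the vacated place costs one sign, so the sum is `α` times a derivation that
preserves the order of the letters. -/
theorem sum_mul_commutator_word {α : G} {c : ι → G}
    (hφ : ∀ j k, φ j * φ k = -(φ k * φ j)) (hα : ∀ j, φ j * α = -(α * φ j))
    (hc : ∀ k j, c k * φ j = φ j * c k + α * β k j)
    {p : ℕ} (f : Fin p → ι) :
    ∑ k, φ k * ((List.ofFn fun l => φ (f l)).prod * c k -
        c k * (List.ofFn fun l => φ (f l)).prod) =
      α * wordDeriv φ (fun j => ∑ k, φ k * β k j) p f := by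
  induction p with
  | zero => simp [wordDeriv]
  | succ p ih =>
    have ih := ih fun l => f l.succ
    simp only [List.ofFn_succ, List.prod_cons, wordDeriv]
    set Q := (List.ofFn fun l : Fin p => φ (f l.succ)).prod
    have key : ∀ k, φ k * (φ (f 0) * Q * c k - c k * (φ (f 0) * Q)) =
        -(φ (f 0) * (φ k * (Q * c k - c k * Q))) + α * (φ k * β k (f 0)) * Q := by
      intro k
      have h1 : φ k * (c k * (φ (f 0) * Q)) =
          φ k * φ (f 0) * c k * Q + φ k * α * β k (f 0) * Q := by
        rw [← mul_assoc (c k), hc]; noncomm_ring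
      rw [mul_sub, h1, hα]
      have h2 : φ k * (φ (f 0) * Q * c k) = φ k * φ (f 0) * (Q * c k) := by noncomm_ring
      rw [h2, hφ k]
      noncomm_ring
    rw [Finset.sum_congr rfl fun k _ => key k, Finset.sum_add_distrib, Finset.sum_neg_distrib,
      ← Finset.mul_sum, ih, ← Finset.sum_mul, ← Finset.mul_sum, ← mul_assoc (φ (f 0)), hα]
    noncomm_ring

/-- The derivation `φ j ↦ ∑ k, φ k β k j` is transferred to the `y`s: `β` commutes with everything
in between, and summing over all words allows the names `j` and `k` to be exchanged. On the `y`s it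
is `y k ↦ ∑ j, β k j y j`, the commutator with `a`. The spacer `z` is there for the induction. -/
theorem sum_wordDeriv_mul {a : G} {p : ℕ} {y : Fin p → ι → G}
    (hβφ : ∀ k j i, Commute (β k j) (φ i)) (hβy : ∀ k j l i, Commute (β k j) (y l i))
    (hay : ∀ l k, a * y l k - y l k * a = ∑ j, β k j * y l j)
    {z : G} (hz : ∀ k j, Commute (β k j) z) :
    ∑ f : Fin p → ι, wordDeriv φ (fun j => ∑ k, φ k * β k j) p f * z *
        (List.ofFn fun l => y l (f l)).prod =
      ∑ f : Fin p → ι, (List.ofFn fun l => φ (f l)).prod * z *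
        (a * (List.ofFn fun l => y l (f l)).prod - (List.ofFn fun l => y l (f l)).prod * a) := by
  induction p generalizing z with
  | zero => simp [wordDeriv]
  | succ p ih =>
    -- After the first letters are split off, `y 0 j` lies between the two remaining words and is
    -- absorbed into the spacer.
    have ih' : ∀ j, _ := fun j => ih (y := fun l => y l.succ) (fun k j l i => hβy k j l.succ i)
      (fun l k => hay l.succ k) (z := z * y 0 j) fun k i => (hz k i).mul_right (hβy k i 0 j)
    simp only [Fin.sum_univ_pi_succ, List.ofFn_succ, List.prod_cons, wordDeriv, Fin.cons_zero,
      Fin.cons_succ]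
    have hP : ∀ (k j : ι) (f : Fin p → ι),
        Commute (β k j) (List.ofFn fun l => φ (f l)).prod := fun k j f =>
      Commute.list_prod_right _ _ fun b hb => by
        obtain ⟨l, rfl⟩ := List.mem_ofFn.1 hb
        exact hβφ _ _ _
    have e1 : ∀ j (f : Fin p → ι),
        ((∑ k, φ k * β k j) * (List.ofFn fun l => φ (f l)).prod +
          φ j * wordDeriv φ (fun j => ∑ k, φ k * β k j) p f) * z *
          (y 0 j * (List.ofFn fun l => y l.succ (f l)).prod) =
        ∑ k, φ k * (List.ofFn fun l => φ (f l)).prod * z * (β k j * y 0 j) *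
          (List.ofFn fun l => y l.succ (f l)).prod +
        φ j * (wordDeriv φ (fun j => ∑ k, φ k * β k j) p f * (z * y 0 j) *
          (List.ofFn fun l => y l.succ (f l)).prod) := by
      intro j f
      rw [add_mul, add_mul, Finset.sum_mul, Finset.sum_mul, Finset.sum_mul]
      congr 1
      · refine Finset.sum_congr rfl fun k _ => ?_
        have := ((hP k j f).mul_right (hz k j)).eq
        calc _ = φ k * (β k j * ((List.ofFn fun l => φ (f l)).prod * z)) *
              (y 0 j * (List.ofFn fun l => y l.succ (f l)).prod) := by noncomm_ring
          _ = _ := by rw [this]; noncomm_ring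
      · noncomm_ring
    have e2 : ∀ j (f : Fin p → ι),
        φ j * (List.ofFn fun l => φ (f l)).prod * z *
          (a * (y 0 j * (List.ofFn fun l => y l.succ (f l)).prod) -
            y 0 j * (List.ofFn fun l => y l.succ (f l)).prod * a) =
        ∑ k, φ j * (List.ofFn fun l => φ (f l)).prod * z * (β j k * y 0 k) *
          (List.ofFn fun l => y l.succ (f l)).prod +
        φ j * ((List.ofFn fun l => φ (f l)).prod * (z * y 0 j) *
          (a * (List.ofFn fun l => y l.succ (f l)).prod -
            (List.ofFn fun l => y l.succ (f l)).prod * a)) := by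
      intro j f
      rw [← Finset.sum_mul, ← Finset.mul_sum, ← hay]
      noncomm_ring
    simp only [e1, e2, Finset.sum_add_distrib]
    congr 1
    · rw [Finset.sum_congr rfl fun j _ => Finset.sum_comm, Finset.sum_comm]
      refine Finset.sum_congr rfl fun k _ => ?_
      rw [Finset.sum_comm]
    · refine Finset.sum_congr rfl fun j _ => ?_
      rw [← Finset.mul_sum, ← Finset.mul_sum, ih' j]

/-- Normal ordering of a product of oscillator-valued odd elements: modulo the left ideal
generated by the annihilation operator `a`, the `φ`s can be moved to the left of the `y`s. -/
theorem exists_prod_eq_normalOrder_add {a : G} {p : ℕ} {y : Fin p → ι → G} {α : Fin p → G}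
    (hφ : ∀ j k, φ j * φ k = -(φ k * φ j)) (hα : ∀ j l, φ j * α l = -(α l * φ j))
    (hyφ : ∀ l k j, y l k * φ j = φ j * y l k + α l * β k j)
    (hβφ : ∀ k j i, Commute (β k j) (φ i))
    (hβy : ∀ k j l i, Commute (β k j) (y l i))
    (haφ : ∀ j, Commute a (φ j)) (haα : ∀ l, Commute a (α l))
    (hay : ∀ l k, a * y l k - y l k * a = ∑ j, β k j * y l j) :
    ∃ s, (List.ofFn fun l => a * α l + ∑ k, φ k * y l k).prod =
      (∑ f : Fin p → ι, (List.ofFn fun l => φ (f l)).prod * (List.ofFn fun l => y l (f l)).prod)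
        + s * a := by
  induction p with
  | zero => exact ⟨0, by simp⟩
  | succ p ih =>
    obtain ⟨s, hs⟩ := ih (y := fun l => y l.succ) (α := fun l => α l.succ)
      (fun j l => hα j l.succ) (fun l => hyφ l.succ)
      (fun k j l => hβy k j l.succ) (fun l => haα l.succ) (fun l => hay l.succ)
    set T := ∑ f : Fin p → ι, (List.ofFn fun l => φ (f l)).prod *
      (List.ofFn fun l => y l.succ (f l)).prod with hT
    have hcomm := sum_wordDeriv_mul (z := 1) hβφ (fun k j l => hβy k j (Fin.succ l))
      (fun l => hay (Fin.succ l)) fun k j => Commute.one_right _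
    have hP : ∀ f : Fin p → ι, Commute a (List.ofFn fun l => φ (f l)).prod := fun f =>
      Commute.list_prod_right _ _ fun b hb => by
        obtain ⟨l, rfl⟩ := List.mem_ofFn.1 hb
        exact haφ _
    have hcomm' : ∑ f : Fin p → ι, wordDeriv φ (fun j => ∑ k, φ k * β k j) p f *
        (List.ofFn fun l => y l.succ (f l)).prod = a * T - T * a := by
      simp only [mul_one] at hcomm
      rw [hcomm, hT, Finset.mul_sum, Finset.sum_mul, ← Finset.sum_sub_distrib]
      refine Finset.sum_congr rfl fun f _ => ?_
      rw [mul_sub, ← mul_assoc, ← (hP f).eq]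
      noncomm_ring
    -- Normal ordering the new `y 0 k` past the `φ`s of `T` produces `α 0 * [a, T]`, which is also
    -- what moving `a` to the right in `a * α 0 * T` leaves behind.
    have hstep : ∑ f : Fin (p + 1) → ι, (List.ofFn fun l => φ (f l)).prod *
        (List.ofFn fun l => y l (f l)).prod = (∑ k, φ k * y 0 k) * T + α 0 * (a * T - T * a) := by
      simp only [Fin.sum_univ_pi_succ, List.ofFn_succ, List.prod_cons, Fin.cons_zero,
        Fin.cons_succ]
      rw [Finset.sum_comm, ← hcomm', hT, Finset.mul_sum, Finset.mul_sum,
        ← Finset.sum_add_distrib]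
      refine Finset.sum_congr rfl fun f _ => ?_
      rw [← mul_assoc, ← mul_assoc, ← sum_mul_commutator_word hφ (fun j => hα j 0) (hyφ 0) f,
        Finset.sum_mul, Finset.sum_mul, Finset.sum_mul, ← Finset.sum_add_distrib]
      refine Finset.sum_congr rfl fun k _ => ?_
      noncomm_ring
    refine ⟨α 0 * T + (a * α 0 + ∑ k, φ k * y 0 k) * s, ?_⟩
    rw [List.ofFn_succ, List.prod_cons, hs, hstep, (haα 0).eq]
    noncomm_ring

end Words

/-! ### Grassmann algebra over a noncommutative ring and Berezin integration. -/

open scoped TensorProduct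

theorem Fintype.sum_eq_zero_of_add_swap {ι M : Type*} [Fintype ι] [AddCommMonoid M]
    (F : ι → ι → M) (h : ∀ i j, F i j + F j i = 0) (hd : ∀ i, F i i = 0) :
    ∑ i, ∑ j, F i j = 0 := by
  rw [← Fintype.sum_prod_type']
  refine Finset.sum_involution (fun x _ => x.swap) (fun x _ => h _ _) (fun x _ hx hs => hx ?_)
    (fun _ _ => Finset.mem_univ _) fun _ _ => rfl
  obtain ⟨i, j⟩ := x
  obtain rfl : j = i := congrArg Prod.fst hs
  exact hd _

theorem List.prod_ofFn_sum {G ι : Type*} [Ring G] [Fintype ι] {n : ℕ} (g : Fin n → ι → G) :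
    (List.ofFn fun l => ∑ i, g l i).prod = ∑ f : Fin n → ι, (List.ofFn fun l => g l (f l)).prod := by
  have := (MultilinearMap.mkPiAlgebraFin ℤ n G).map_sum g
  simpa only [MultilinearMap.mkPiAlgebraFin_apply] using this

/-- The algebra of a Grassmann algebra on `n` generators with coefficients in `S`. -/
abbrev Grassmann (n : ℕ) (S : Type*) [Ring S] : Type _ :=
  ExteriorAlgebra ℤ (Fin n → ℤ) ⊗[ℤ] S

namespace Grassmann

variable {n : ℕ} {S : Type*} [Ring S]

/-- The `i`-th generator. -/
noncomputable def gen (i : Fin n) : ExteriorAlgebra ℤ (Fin n → ℤ) :=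
  ExteriorAlgebra.ι ℤ (Pi.single i 1)

/-- The element `∑ i, θ i * c i` of degree one. -/
noncomputable def odd (c : Fin n → S) : Grassmann n S :=
  ∑ i, gen i ⊗ₜ[ℤ] c i

/-- The inclusion of the coefficients. -/
noncomputable def coeff (S : Type*) [Ring S] (n : ℕ) : S →+* Grassmann n S :=
  (Algebra.TensorProduct.includeRight : S →ₐ[ℤ] Grassmann n S).toRingHom

theorem coeff_apply (s : S) : coeff S n s = 1 ⊗ₜ[ℤ] s := rfl

theorem odd_add (c d : Fin n → S) : odd (c + d) = odd c + odd d := by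
  simp [odd, TensorProduct.tmul_add, Finset.sum_add_distrib]

theorem odd_mul_coeff (c : Fin n → S) (s : S) : odd c * coeff S n s = odd fun i => c i * s := by
  simp [odd, coeff_apply, Finset.sum_mul]

theorem coeff_mul_odd (c : Fin n → S) (s : S) : coeff S n s * odd c = odd fun i => s * c i := by
  simp [odd, coeff_apply, Finset.mul_sum]

theorem odd_sum {κ : Type*} (t : Finset κ) (c : κ → Fin n → S) :
    odd (fun i => ∑ k ∈ t, c k i) = ∑ k ∈ t, odd (c k) := by
  simp only [odd, TensorProduct.tmul_sum]
  exact Finset.sum_comm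

theorem gen_mul_gen_swap (i k : Fin n) :
    gen k * gen i =
      -(gen i * gen k) :=
  eq_neg_of_add_eq_zero_left (ExteriorAlgebra.ι_add_mul_swap _ _)

theorem sum_gen_mul_gen_tmul_eq_zero (g : Fin n → Fin n → S) (hg : ∀ i k, g i k = g k i) :
    ∑ i, ∑ k, (gen i *
      gen k) ⊗ₜ[ℤ] g i k = 0 := by
  refine Fintype.sum_eq_zero_of_add_swap _ (fun i k => ?_) fun i => ?_
  · rw [gen_mul_gen_swap i k, hg k i, TensorProduct.neg_tmul, add_neg_cancel]
  · rw [gen, ExteriorAlgebra.ι_sq_zero, TensorProduct.zero_tmul]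

theorem odd_mul_odd (c d : Fin n → S) : odd c * odd d =
    ∑ i, ∑ k, (gen i *
      gen k) ⊗ₜ[ℤ] (c i * d k) := by
  simp [odd, Finset.sum_mul_sum]

/-- The hypothesis rearranges to the symmetry of `c i * d k + d i * c k` in `i` and `k`, and
symmetric coefficients are killed by the antisymmetry of the products of two generators. -/
theorem odd_anticomm {c d : Fin n → S} (h : ∀ i k, ⁅c i, d k⁆ = ⁅c k, d i⁆) :
    odd c * odd d = -(odd d * odd c) := by
  rw [eq_neg_iff_add_eq_zero, odd_mul_odd, odd_mul_odd]
  simp only [← Finset.sum_add_distrib, ← TensorProduct.tmul_add]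
  refine sum_gen_mul_gen_tmul_eq_zero _ fun i k => ?_
  have := h i k
  rw [Ring.lie_def, Ring.lie_def, sub_eq_sub_iff_add_eq_add] at this
  rw [this]

/-- Needed apart from anticommutation, which only gives twice the square equal to zero, and `2` may
be a zero divisor. -/
theorem odd_mul_self {c : Fin n → S} (h : ∀ i k, Commute (c i) (c k)) : odd c * odd c = 0 := by
  rw [odd_mul_odd]
  exact sum_gen_mul_gen_tmul_eq_zero _ fun i k => h i k

/-- The coefficient of the product `θ 0 * θ 1 * ⋯` of all the generators. -/
noncomputable def top (n : ℕ) : ExteriorAlgebra ℤ (Fin n → ℤ) →ₗ[ℤ] ℤ :=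
  ExteriorAlgebra.liftAlternating (R := ℤ) (M := Fin n → ℤ) (N := ℤ) fun i =>
    if h : i = n then h ▸ Matrix.detRowAlternating else 0

theorem top_prod (v : Fin n → Fin n → ℤ) :
    top n (List.ofFn fun l => ExteriorAlgebra.ι ℤ (v l)).prod = (Matrix.of v).det := by
  rw [← ExteriorAlgebra.ιMulti_apply, top, ExteriorAlgebra.liftAlternating_apply_ιMulti]
  simp only [dite_true]
  rfl

/-- The `S`-valued coefficient of the product of all the generators (Berezin integration). -/
noncomputable def berezin (n : ℕ) (S : Type*) [Ring S] : Grassmann n S →+ S :=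
  ((TensorProduct.lid ℤ S).toLinearMap ∘ₗ
    TensorProduct.map (top n) LinearMap.id).toAddMonoidHom

theorem berezin_tmul (e : ExteriorAlgebra ℤ (Fin n → ℤ)) (s : S) :
    berezin n S (e ⊗ₜ s) = top n e • s :=
  TensorProduct.lid_tmul (R := ℤ) s (top n e)

/-- Linearity on the right keeps a left multiple of the annihilation operator of that form after
integration. -/
theorem berezin_mul_coeff (g : Grassmann n S) (s : S) :
    berezin n S (g * coeff S n s) = berezin n S g * s := by
  induction g using TensorProduct.induction_on with
  | zero => simp
  | add x y hx hy => rw [add_mul, map_add, hx, hy, map_add, add_mul]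
  | tmul e r =>
    rw [coeff_apply, Algebra.TensorProduct.tmul_mul_tmul, mul_one, berezin_tmul, berezin_tmul,
      smul_mul_assoc]

theorem prod_tmul {p : ℕ} (e : Fin p → ExteriorAlgebra ℤ (Fin n → ℤ)) (s : Fin p → S) :
    (List.ofFn fun l => (e l ⊗ₜ[ℤ] s l : Grassmann n S)).prod =
      (List.ofFn e).prod ⊗ₜ (List.ofFn s).prod := by
  induction p with
  | zero => simp [Algebra.TensorProduct.one_def]
  | succ p ih => simp [List.ofFn_succ, ih]

/-- The column-determinant is the Berezin integral of the product of the odd elements attached to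
the columns. -/
theorem berezin_prod_odd (M : Matrix (Fin n) (Fin n) S) :
    berezin n S (List.ofFn fun l => odd fun i => M i l).prod = colDet M := by
  simp only [odd, gen]
  rw [List.prod_ofFn_sum, map_sum]
  simp only [prod_tmul, berezin_tmul, top_prod]
  rw [← Finset.sum_subset (Finset.subset_univ
    (Finset.univ.map ⟨fun σ : Equiv.Perm (Fin n) => (σ : Fin n → Fin n), DFunLike.coe_injective⟩))]
  · rw [Finset.sum_map, colDet]
    refine Finset.sum_congr rfl fun σ _ => ?_
    congr 1
    have : Matrix.of (fun l => Pi.single (σ l) (1 : ℤ)) =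
        (1 : Matrix (Fin n) (Fin n) ℤ).submatrix σ id := by
      ext l j
      simp [Matrix.one_apply, Pi.single_apply, eq_comm]
    simp [this, Matrix.det_permute]
  · intro f _ hf
    have hinj : ¬ Function.Injective f := fun h => hf <| Finset.mem_map.2
      ⟨Equiv.ofBijective f (Finite.injective_iff_bijective.1 h), Finset.mem_univ _, rfl⟩
    obtain ⟨i, j, hij, hne⟩ := Function.not_injective_iff.1 hinj
    rw [Matrix.det_zero_of_row_eq hne (by ext k; simp [hij]), zero_smul]

end Grassmann

/-! ### Words in anticommuting elements of square zero. -/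

section Anticommuting

variable {G : Type*} [Ring G] {m : ℕ} {φ : Fin m → G}

/-- The relations are those of an exterior algebra, so its universal property applies; sign rules
for words then follow from those of alternating maps. -/
theorem exists_alternatingMap_prod (hφ : ∀ j k, φ j * φ k = -(φ k * φ j))
    (hsq : ∀ j, φ j * φ j = 0) (n : ℕ) :
    ∃ A : (Fin m → ℤ) [⋀^Fin n]→ₗ[ℤ] G, ∀ f : Fin n → Fin m,
      A (fun l => Pi.single (f l) 1) = (List.ofFn fun l => φ (f l)).prod := by
  have h0 : ∀ v : Fin m → ℤ,
      Fintype.linearCombination ℤ φ v * Fintype.linearCombination ℤ φ v = 0 := by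
    intro v
    rw [Fintype.linearCombination_apply, Finset.sum_mul_sum]
    refine Fintype.sum_eq_zero_of_add_swap _ (fun i j => ?_) fun i => ?_
    · rw [smul_mul_smul_comm, smul_mul_smul_comm, hφ j i, mul_comm (v j), smul_neg,
        add_neg_cancel]
    · rw [smul_mul_smul_comm, hsq, smul_zero]
  refine ⟨(ExteriorAlgebra.lift ℤ
    ⟨Fintype.linearCombination ℤ φ, h0⟩).toLinearMap.compAlternatingMap (ExteriorAlgebra.ιMulti ℤ n), fun f => ?_⟩
  simp only [LinearMap.compAlternatingMap_apply, ExteriorAlgebra.ιMulti_apply,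
    AlgHom.toLinearMap_apply, map_list_prod, List.map_ofFn]
  congr 2
  funext l
  simp [Fintype.linearCombination_apply_single]

theorem prod_comp_perm_of_anticomm (hφ : ∀ j k, φ j * φ k = -(φ k * φ j))
    (hsq : ∀ j, φ j * φ j = 0) {n : ℕ} (f : Fin n → Fin m) (σ : Equiv.Perm (Fin n)) :
    (List.ofFn fun l => φ (f (σ l))).prod =
      ((Equiv.Perm.sign σ : ℤˣ) : ℤ) • (List.ofFn fun l => φ (f l)).prod := by
  obtain ⟨A, hA⟩ := exists_alternatingMap_prod hφ hsq n
  rw [← hA f, ← hA fun l => f (σ l)]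
  exact A.map_perm (fun l => Pi.single (f l) (1 : ℤ)) σ

theorem prod_eq_zero_of_anticomm (hφ : ∀ j k, φ j * φ k = -(φ k * φ j))
    (hsq : ∀ j, φ j * φ j = 0) {n : ℕ} {f : Fin n → Fin m} (hf : ¬ Function.Injective f) :
    (List.ofFn fun l => φ (f l)).prod = 0 := by
  obtain ⟨A, hA⟩ := exists_alternatingMap_prod hφ hsq n
  obtain ⟨i, j, hij, hne⟩ := Function.not_injective_iff.1 hf
  rw [← hA]
  exact A.map_eq_zero_of_eq _ (by rw [hij]) hne

end Anticommuting

/-! ### Minors of Manin matrices and the Cauchy–Binet expansion. -/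

section Manin

open Grassmann

variable {S : Type*} [Ring S] {n m : ℕ} {x : Matrix (Fin n) (Fin m) S}

theorem IsRowPseudoComm.odd_anticomm (hx : IsRowPseudoComm x) (j k : Fin m) :
    (odd fun i => x i j) * (odd fun i => x i k) = -((odd fun i => x i k) * odd fun i => x i j) :=
  Grassmann.odd_anticomm fun i i' => hx.1 j i k i'

theorem IsRowPseudoComm.odd_mul_self (hx : IsRowPseudoComm x) (j : Fin m) :
    (odd fun i => x i j) * (odd fun i => x i j) = 0 :=
  Grassmann.odd_mul_self fun i k => by
    have := hx.2 j i k
    rwa [Ring.lie_def, sub_eq_zero] at this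

theorem IsRowPseudoComm.colDet_submatrix_perm (hx : IsRowPseudoComm x) (f : Fin n → Fin m)
    (σ : Equiv.Perm (Fin n)) :
    colDet (x.submatrix id (f ∘ σ)) =
      ((Equiv.Perm.sign σ : ℤˣ) : ℤ) • colDet (x.submatrix id f) := by
  rw [← berezin_prod_odd, ← berezin_prod_odd, ← map_zsmul]
  exact congrArg _ (prod_comp_perm_of_anticomm (φ := fun j => odd fun i => x i j)
    hx.odd_anticomm hx.odd_mul_self f σ)

theorem IsRowPseudoComm.colDet_submatrix_eq_zero (hx : IsRowPseudoComm x) {f : Fin n → Fin m}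
    (hf : ¬ Function.Injective f) : colDet (x.submatrix id f) = 0 := by
  rw [← berezin_prod_odd]
  exact (congrArg _ (prod_eq_zero_of_anticomm (φ := fun j => odd fun i => x i j)
    hx.odd_anticomm hx.odd_mul_self hf)).trans (map_zero _)

/-- An injective map is, in exactly one way, a permutation followed by the increasing enumeration of
its image. -/
theorem sum_injective_eq_sum_subsets {M : Type*} [AddCommMonoid M] (F : (Fin n → Fin m) → M)
    (hF : ∀ f, ¬ Function.Injective f → F f = 0) :
    ∑ f, F f = ∑ L : Subsets m n, ∑ σ : Equiv.Perm (Fin n), F (L.1.orderEmbOfFin L.2 ∘ σ) := by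
  rw [← Fintype.sum_prod_type']
  symm
  have hinj : ∀ x : Subsets m n × Equiv.Perm (Fin n),
      Function.Injective (x.1.1.orderEmbOfFin x.1.2 ∘ x.2) := fun x =>
    (x.1.1.orderEmbOfFin x.1.2).injective.comp x.2.injective
  have himg : ∀ x : Subsets m n × Equiv.Perm (Fin n),
      Finset.univ.image (x.1.1.orderEmbOfFin x.1.2 ∘ x.2) = x.1.1 := by
    intro x
    rw [← Finset.image_image, Finset.image_univ_equiv]
    exact Finset.image_orderEmbOfFin_univ _ _
  refine Finset.sum_of_injOn (fun x => x.1.1.orderEmbOfFin x.1.2 ∘ x.2) ?_ (by simp) ?_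
    (fun _ _ => rfl)
  · rintro ⟨L, σ⟩ _ ⟨L', σ'⟩ _ h
    obtain rfl : L = L' := Subtype.ext <| by
      rw [← himg (L, σ), ← himg (L', σ')]
      exact congrArg (Finset.univ.image ·) h
    congr 1
    ext1 i
    exact (L.1.orderEmbOfFin L.2).injective (congrFun h i)
  · intro f _ hf
    refine hF f fun hi => hf ?_
    have hc : (Finset.univ.image f).card = n := by
      rw [Finset.card_image_of_injective _ hi, Finset.card_fin]
    let L : Subsets m n := ⟨Finset.univ.image f, hc⟩
    have hr : ∀ i, ∃ k, L.1.orderEmbOfFin L.2 k = f i := fun i => by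
      have : f i ∈ Set.range (L.1.orderEmbOfFin L.2) := by
        rw [Finset.range_orderEmbOfFin]
        exact Finset.mem_coe.2 (Finset.mem_image_of_mem f (Finset.mem_univ i))
      exact this
    choose g hg using hr
    have hgi : Function.Injective g := fun i j h => hi (by rw [← hg, ← hg, h])
    exact ⟨(L, Equiv.ofBijective g (Finite.injective_iff_bijective.1 hgi)), by simp,
      funext hg⟩

/-- The Cauchy–Binet expansion, as a sum over all the choices of columns. -/
theorem IsRowPseudoComm.sum_colDet_mul_colDet (hx : IsRowPseudoComm x)
    (y : Matrix (Fin m) (Fin n) S) :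
    ∑ L : Subsets m n, colDet (colMinor x L) * colDet (rowMinor y L) =
      ∑ f : Fin n → Fin m, colDet (x.submatrix id f) * (List.ofFn fun l => y (f l) l).prod := by
  rw [sum_injective_eq_sum_subsets _ fun f hf => by rw [hx.colDet_submatrix_eq_zero hf, zero_mul]]
  refine Finset.sum_congr rfl fun L _ => ?_
  rw [colDet.eq_1 (rowMinor y L), Finset.mul_sum]
  refine Finset.sum_congr rfl fun σ _ => ?_
  rw [hx.colDet_submatrix_perm, mul_smul_comm, smul_mul_assoc]
  rfl

end Manin

/-! ### The column identity in an abstract oscillator algebra. -/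

open Grassmann in
/-- Normal ordering of a column-determinant, modulo the left ideal generated by `a`. -/
theorem exists_colDet_eq_normalOrder_add {S : Type*} [Ring S] {n m : ℕ} {a : S}
    {x : Matrix (Fin n) (Fin m) S} {y : Matrix (Fin m) (Fin n) S}
    {α : Matrix (Fin n) (Fin n) S} {β : Matrix (Fin m) (Fin m) S}
    (hx : IsRowPseudoComm x) (hα : ∀ i j k l, ⁅x i j, α k l⁆ = ⁅x k j, α i l⁆)
    (hyx : ∀ i j k l, y k l * x i j = x i j * y k l + α i l * β k j)
    (hβx : ∀ k j i l, Commute (β k j) (x i l)) (hβy : ∀ k j i l, Commute (β k j) (y i l))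
    (hax : ∀ i j, Commute a (x i j)) (haα : ∀ i j, Commute a (α i j))
    (hay : ∀ k l, a * y k l - y k l * a = ∑ j, β k j * y j l) :
    ∃ s, colDet (a • α + x * y) =
      (∑ f : Fin n → Fin m, colDet (x.submatrix id f) * (List.ofFn fun l => y (f l) l).prod)
        + s * a := by
  obtain ⟨s, hs⟩ := exists_prod_eq_normalOrder_add (G := Grassmann n S) (a := coeff S n a)
    (p := n) (φ := fun j => odd fun i => x i j) (y := fun l k => coeff S n (y k l))
    (α := fun l => odd fun i => α i l) (β := fun k j => coeff S n (β k j))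
    hx.odd_anticomm (fun j l => odd_anticomm fun i k => hα i j k l)
    (fun l k j => by
      rw [coeff_mul_odd, odd_mul_coeff, odd_mul_coeff, ← odd_add]
      congr 1
      funext i
      exact hyx i j k l)
    (fun k j i => by
      rw [Commute, SemiconjBy, coeff_mul_odd, odd_mul_coeff]
      congr 1
      funext l
      exact hβx k j l i)
    (fun k j l i => (hβy k j i l).map _)
    (fun j => by
      rw [Commute, SemiconjBy, coeff_mul_odd, odd_mul_coeff]
      congr 1
      funext i
      exact hax i j)
    (fun l => by
      rw [Commute, SemiconjBy, coeff_mul_odd, odd_mul_coeff]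
      congr 1
      funext i
      exact haα i l)
    (fun l k => by simp only [← map_mul, ← map_sub, hay, map_sum])
  refine ⟨berezin n S s, ?_⟩
  have hM : ∀ l, coeff S n a * (odd fun i => α i l) +
      ∑ k, (odd fun i => x i k) * coeff S n (y k l) = odd fun i => (a • α + x * y) i l := by
    intro l
    simp only [coeff_mul_odd, odd_mul_coeff]
    rw [← odd_sum, ← odd_add]
    rfl
  simp only [hM] at hs
  rw [← berezin_prod_odd, hs, map_add, berezin_mul_coeff, map_sum]
  congr 1
  refine Finset.sum_congr rfl fun f _ => ?_
  have : (List.ofFn fun l => coeff S n (y (f l) l)).prod =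
      coeff S n (List.ofFn fun l => y (f l) l).prod := by
    rw [map_list_prod, List.map_ofFn]
    rfl
  rw [this, berezin_mul_coeff, ← berezin_prod_odd]
  rfl

theorem colDet_map {R S : Type*} [Ring R] [Ring S] (g : R →+* S) {n : ℕ}
    (M : Matrix (Fin n) (Fin n) R) : colDet (M.map g) = g (colDet M) := by
  simp only [colDet, map_sum, map_zsmul, map_list_prod, List.map_ofFn]
  rfl

theorem IsColPseudoComm.map {R S : Type*} [Ring R] [Ring S] (g : R →+* S) {p q : ℕ}
    {M : Matrix (Fin p) (Fin q) R} (hM : IsColPseudoComm M) : IsColPseudoComm (M.map g) := by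
  constructor
  · intro i j k l
    have := congrArg g (hM.1 i j k l)
    simpa only [Ring.lie_def, map_sub, map_mul, Matrix.map_apply] using this
  · intro i j l
    have := congrArg g (hM.2 i j l)
    simpa only [Ring.lie_def, map_sub, map_mul, map_zero, Matrix.map_apply] using this

/-- What commutes with the entries of a matrix commutes with those of its inverse. -/
theorem Matrix.commute_apply_of_mul_eq_one {κ S : Type*} [Fintype κ] [DecidableEq κ] [Ring S]
    {C D : Matrix κ κ S} (hCD : C * D = 1) (hDC : D * C = 1) {s : S}
    (hs : ∀ i j, Commute s (D i j)) (i j : κ) : Commute s (C i j) := by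
  have h : Matrix.diagonal (fun _ => s) * D = D * Matrix.diagonal fun _ => s := by
    ext i j
    rw [Matrix.diagonal_mul, Matrix.mul_diagonal]
    exact hs i j
  have h' : Matrix.diagonal (fun _ => s) * C = C * Matrix.diagonal fun _ => s := by
    calc _ = C * D * (Matrix.diagonal (fun _ => s) * C) := by rw [hCD, one_mul]
      _ = C * (D * Matrix.diagonal fun _ => s) * C := by simp only [mul_assoc]
      _ = C * (Matrix.diagonal fun _ => s) * (D * C) := by rw [← h]; simp only [mul_assoc]
      _ = _ := by rw [hDC, mul_one]
  have := congrFun (congrFun h' i) j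
  rwa [Matrix.diagonal_mul, Matrix.mul_diagonal] at this

section Oscillator

variable {R S : Type*} [Ring R] [Ring S] {n m : ℕ} {ι : R →+* S} {ν : S →+ R} {a c : S}
  {X : Matrix (Fin n) (Fin m) R} {Y : Matrix (Fin m) (Fin n) R}
  {A : Matrix (Fin n) (Fin n) R} {B : Matrix (Fin m) (Fin m) R} {C : Matrix (Fin m) (Fin m) S}

/-- As `c` commutes with the scalars, congruence to scalars modulo the right ideal `c * S` is
compatible with products. -/
theorem exists_prod_eq_add_mul (hc : ∀ r, Commute c (ι r)) {p : ℕ} (y : Fin p → S)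
    (r : Fin p → R) (h : ∀ l, ∃ s, y l = ι (r l) + c * s) :
    ∃ s, (List.ofFn y).prod = ι (List.ofFn r).prod + c * s := by
  induction p with
  | zero => exact ⟨0, by simp⟩
  | succ p ih =>
    obtain ⟨s, hs⟩ := ih (fun l => y l.succ) (fun l => r l.succ) fun l => h l.succ
    obtain ⟨t, ht⟩ := h 0
    refine ⟨ι (r 0) * s + t * (ι (List.ofFn fun l => r l.succ).prod + c * s), ?_⟩
    rw [List.ofFn_succ, List.prod_cons, hs, ht, List.ofFn_succ, List.prod_cons, map_mul, mul_add,
      add_mul, add_mul, mul_add c, ← mul_assoc c (ι (r 0)), (hc (r 0)).eq]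
    noncomm_ring

theorem commute_oneSub_apply {s : S} (hs : Commute s c) (hB : ∀ i j, Commute s (ι (B i j)))
    (i j : Fin m) : Commute s ((1 - c • B.map ι) i j) := by
  rw [Matrix.sub_apply, Matrix.smul_apply, Matrix.map_apply, smul_eq_mul]
  refine Commute.sub_right ?_ (hs.mul_right (hB i j))
  rw [Matrix.one_apply]
  split_ifs
  exacts [Commute.one_right _, Commute.zero_right _]

/-- The rule for differentiating an inverse: with `D = 1 - c B`, `[a, D] = -B` and hence `[a, C] =
-C [a, D] C`. -/
theorem annihilate_mul_inverse_sub (hac : a * c - c * a = 1) (ha : ∀ r, Commute a (ι r))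
    (hCD : C * (1 - c • B.map ι) = 1) (hDC : (1 - c • B.map ι) * C = 1) :
    Matrix.diagonal (fun _ => a) * C - C * Matrix.diagonal (fun _ => a) = C * B.map ι * C := by
  have h : Matrix.diagonal (fun _ => a) * (1 - c • B.map ι) -
      (1 - c • B.map ι) * Matrix.diagonal (fun _ => a) = -B.map ι := by
    ext i j
    have h1 : Commute a ((1 : Matrix (Fin m) (Fin m) S) i j) := by
      rw [Matrix.one_apply]
      split_ifs
      exacts [Commute.one_right _, Commute.zero_right _]
    rw [Matrix.sub_apply, Matrix.diagonal_mul, Matrix.mul_diagonal, Matrix.sub_apply, mul_sub,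
      sub_mul, h1.eq, sub_sub_sub_cancel_left, Matrix.smul_apply, Matrix.map_apply, smul_eq_mul,
      mul_assoc, ← (ha _).eq, ← mul_assoc, ← mul_assoc, ← sub_mul, ← neg_sub, hac]
    simp
  calc _ = C * (1 - c • B.map ι) * (Matrix.diagonal (fun _ => a) * C) -
        C * Matrix.diagonal (fun _ => a) * ((1 - c • B.map ι) * C) := by
        rw [hCD, hDC, one_mul, mul_one]
    _ = -(C * (Matrix.diagonal (fun _ => a) * (1 - c • B.map ι) -
      (1 - c • B.map ι) * Matrix.diagonal (fun _ => a)) * C) := by noncomm_ring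
    _ = _ := by rw [h]; noncomm_ring

/-- The Cauchy–Binet–Capelli identity for column-determinants in an abstract oscillator algebra:
`a` and `c` are the annihilation and creation operators, `ν` is the vacuum expectation value. -/
theorem sum_colDet_mul_colDet_eq_vev
    (hac : a * c - c * a = 1) (ha : ∀ r, Commute a (ι r)) (hc : ∀ r, Commute c (ι r))
    (hν : ∀ r, ν (ι r) = r) (hνa : ∀ s, ν (s * a) = 0) (hνc : ∀ s, ν (c * s) = 0)
    (hCD : C * (1 - c • B.map ι) = 1) (hDC : (1 - c • B.map ι) * C = 1)
    (hXY : ∀ i j k l, ⁅X i j, Y k l⁆ = -(A i l * B k j))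
    (hB : ∀ i j, B i j ∈ Subring.center R) (hX : IsRowPseudoComm X)
    (hXA : ∀ i j k l, ⁅X i j, A k l⁆ - ⁅X k j, A i l⁆ = 0) :
    ∑ L : Subsets m n, colDet (colMinor X L) * colDet (rowMinor Y L) =
      ν (colDet (a • A.map ι + X.map ι * C * Y.map ι)) := by
  have hBr : ∀ r i j, Commute (ι r) (ι (B i j)) := fun r i j =>
    Commute.map (Subring.mem_center_iff.1 (hB i j) r) ι
  have hCr : ∀ r i j, Commute (ι r) (C i j) := fun r =>
    Matrix.commute_apply_of_mul_eq_one hCD hDC (commute_oneSub_apply (hc r).symm (hBr r))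
  have hCc : ∀ i j, Commute c (C i j) :=
    Matrix.commute_apply_of_mul_eq_one hCD hDC
      (commute_oneSub_apply (Commute.refl c) fun i j => hc (B i j))
  have hCC : ∀ k l i j, Commute (C k l) (C i j) := fun k l =>
    Matrix.commute_apply_of_mul_eq_one hCD hDC
      (commute_oneSub_apply (hCc k l).symm fun i j => (hCr (B i j) k l).symm)
  set x := X.map ι with hx
  set y := C * Y.map ι with hy
  have hyapp : ∀ k l, y k l = ∑ p, C k p * ι (Y p l) := fun k l => Matrix.mul_apply
  have hβapp : ∀ k j, (C * B.map ι) k j = ∑ p, C k p * ι (B p j) := fun k l => Matrix.mul_apply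
  have hβr : ∀ r k j, Commute (ι r) ((C * B.map ι) k j) := fun r k j => by
    rw [hβapp]
    exact Commute.sum_right _ _ _ fun p _ => (hCr r k p).mul_right (hBr r p j)
  have hβC : ∀ k j i l, Commute (C i l) ((C * B.map ι) k j) := fun k j i l => by
    rw [hβapp]
    exact Commute.sum_right _ _ _ fun p _ => (hCC i l k p).mul_right (hCr _ _ _).symm
  obtain ⟨s, hs⟩ := exists_colDet_eq_normalOrder_add (a := a) (x := x) (y := y) (α := A.map ι)
    (β := C * B.map ι) (IsColPseudoComm.map ι hX)
    (fun i j k l => by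
      have := congrArg ι (sub_eq_zero.1 (hXA i j k l))
      simpa only [hx, Ring.lie_def, map_sub, map_mul, Matrix.map_apply] using this)
    (fun i j k l => by
      rw [hyapp, hβapp, Finset.sum_mul, Finset.mul_sum, Finset.mul_sum, ← Finset.sum_add_distrib]
      refine Finset.sum_congr rfl fun p _ => ?_
      have h1 := congrArg ι (hXY i j p l)
      rw [Ring.lie_def, map_sub, map_mul, map_mul, map_neg, map_mul] at h1
      have h2 : ι (Y p l) * ι (X i j) = ι (X i j) * ι (Y p l) + ι (A i l) * ι (B p j) := by
        rw [← neg_neg (ι (A i l) * ι (B p j)), ← h1]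
        abel
      rw [hx, Matrix.map_apply, Matrix.map_apply, mul_assoc, h2, mul_add, ← mul_assoc,
        ← mul_assoc, ← (hCr _ _ _).eq, ← (hCr _ _ _).eq, mul_assoc, mul_assoc])
    (fun k j i l => (hβr _ k j).symm)
    (fun k j i l => by
      rw [hyapp]
      exact Commute.sum_right _ _ _ fun p _ => (hβC _ _ _ _).symm.mul_right (hβr _ _ _).symm)
    (fun i j => ha _) (fun i j => ha _)
    (fun k l => by
      have h := congrArg (fun M : Matrix (Fin m) (Fin m) S => (M * Y.map ι) k l)
        (annihilate_mul_inverse_sub hac ha hCD hDC)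
      have hY : Matrix.diagonal (fun _ : Fin m => a) * Y.map ι =
          Y.map ι * Matrix.diagonal fun _ : Fin n => a := by
        ext i j
        rw [Matrix.diagonal_mul, Matrix.mul_diagonal]
        exact ha _
      simp only [Matrix.sub_mul, Matrix.mul_assoc, hY] at h
      rw [← Matrix.mul_assoc C, ← Matrix.mul_assoc C, ← hy, Matrix.sub_apply,
        Matrix.diagonal_mul, Matrix.mul_diagonal, Matrix.mul_apply] at h
      exact h)
  -- The first step of the geometric series: it shows that `y` and `Y` agree modulo left multiples
  -- of `c`.
  have hCeq : C = 1 + c • (B.map ι * C) := by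
    rw [sub_mul, one_mul, Matrix.smul_mul, sub_eq_iff_eq_add] at hDC
    exact hDC
  have hyeq : ∀ k l, ∃ t, y k l = ι (Y k l) + c * t := fun k l =>
    ⟨(B.map ι * C * Y.map ι) k l, by
      have : y = Y.map ι + c • (B.map ι * C * Y.map ι) := by
        rw [hy]
        nth_rewrite 1 [hCeq]
        rw [Matrix.add_mul, Matrix.one_mul, Matrix.smul_mul]
      rw [this]
      rfl⟩
  rw [hX.sum_colDet_mul_colDet, Matrix.mul_assoc, ← hy, hs, map_add, hνa, add_zero, map_sum]
  refine Finset.sum_congr rfl fun f _ => ?_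
  obtain ⟨t, ht⟩ := exists_prod_eq_add_mul hc _ (fun l => Y (f l) l) fun l => hyeq (f l) l
  rw [ht, hx, Matrix.submatrix_map, colDet_map, mul_add, ← map_mul, ← mul_assoc,
    ← (hc _).eq, mul_assoc, map_add, hν, hνc, add_zero]

end Oscillator

/-! ### Passage to the opposite ring and the row identity. -/

section Opposite

open MulOpposite

theorem MulOpposite.op_prod_ofFn {S : Type*} [Monoid S] {n : ℕ} (f : Fin n → S) :
    op (List.ofFn f).prod = (List.ofFn fun i => op (f i.rev)).prod := by
  rw [op_list_prod, List.map_ofFn]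
  congr 1
  refine List.ext_getElem (by simp) fun i h1 h2 => ?_
  simp only [List.getElem_reverse, List.getElem_ofFn, List.length_ofFn, Function.comp_apply]
  congr 2
  ext
  simp only [Fin.val_rev]
  omega

theorem colDet_submatrix_perm_left {S : Type*} [Ring S] {n : ℕ} (M : Matrix (Fin n) (Fin n) S)
    (τ : Equiv.Perm (Fin n)) :
    colDet (M.submatrix τ id) = ((Equiv.Perm.sign τ : ℤˣ) : ℤ) • colDet M := by
  rw [colDet, colDet, Finset.smul_sum]
  refine Fintype.sum_equiv (Equiv.mulLeft τ) _ _ fun σ => ?_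
  rw [smul_smul, Equiv.coe_mulLeft, Equiv.Perm.sign_mul, ← Units.val_mul, ← mul_assoc,
    Int.units_mul_self, one_mul]
  rfl

/-- The transpose of the row- and column-reversed matrix over the opposite ring. -/
def oppositeMatrix {S : Type*} {n : ℕ} (M : Matrix (Fin n) (Fin n) S) :
    Matrix (Fin n) (Fin n) Sᵐᵒᵖ :=
  Matrix.of fun i j => op (M j.rev i.rev)

theorem oppositeMatrix_apply {S : Type*} {n : ℕ} (M : Matrix (Fin n) (Fin n) S) (i j : Fin n) :
    oppositeMatrix M i j = op (M j.rev i.rev) := rfl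

theorem colDet_oppositeMatrix {S : Type*} [Ring S] {n : ℕ} (M : Matrix (Fin n) (Fin n) S) :
    colDet (oppositeMatrix M) = op (rowDet M) := by
  -- Taking opposites reverses each product; conjugating `σ` by the order reversal restores the
  -- order and keeps the sign.
  rw [rowDet, colDet, Finset.op_sum, ← (MulAut.conj (Fin.revPerm (n := n))).toEquiv.sum_comp]
  refine Finset.sum_congr rfl fun σ _ => ?_
  have hs : Equiv.Perm.sign ((MulAut.conj (Fin.revPerm (n := n))).toEquiv σ) =
      Equiv.Perm.sign σ := by
    change Equiv.Perm.sign (Fin.revPerm * σ * Fin.revPerm⁻¹) = _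
    rw [Equiv.Perm.sign_mul, Equiv.Perm.sign_mul, Equiv.Perm.sign_inv, mul_right_comm,
      Int.units_mul_self, one_mul]
  rw [hs, op_smul, op_prod_ofFn]
  congr 3
  funext i
  simp [oppositeMatrix, MulAut.conj_apply]

variable {R S : Type*} [Ring R] [Ring S] {n m : ℕ} {ι : R →+* S} {ν : S →+ R} {a c : S}
  {X : Matrix (Fin n) (Fin m) R} {Y : Matrix (Fin m) (Fin n) R}
  {A : Matrix (Fin n) (Fin n) R} {B : Matrix (Fin m) (Fin m) R} {C : Matrix (Fin m) (Fin m) S}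

/-- The Cauchy–Binet–Capelli identity for row-determinants in an abstract oscillator algebra:
`a` and `c` are the annihilation and creation operators, `ν` is the vacuum expectation value. -/
theorem sum_rowDet_mul_rowDet_eq_vev
    (hac : a * c - c * a = 1) (ha : ∀ r, Commute a (ι r)) (hc : ∀ r, Commute c (ι r))
    (hν : ∀ r, ν (ι r) = r) (hνa : ∀ s, ν (s * a) = 0) (hνc : ∀ s, ν (c * s) = 0)
    (hCD : C * (1 - a • B.map ι) = 1) (hDC : (1 - a • B.map ι) * C = 1)
    (hXY : ∀ i j k l, ⁅X i j, Y k l⁆ = -(A i l * B k j))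
    (hB : ∀ i j, B i j ∈ Subring.center R) (hY : IsColPseudoComm Y)
    (hYA : ∀ i j k l, ⁅Y i j, A k l⁆ - ⁅Y i l, A k j⁆ = 0) :
    ∑ L : Subsets m n, rowDet (colMinor X L) * rowDet (rowMinor Y L) =
      ν (rowDet (c • A.map ι + X.map ι * C * Y.map ι)) := by
  have op_lie : ∀ u v : R, ⁅op u, op v⁆ = op ⁅v, u⁆ := fun u v => by
    simp [Ring.lie_def]
  let X' : Matrix (Fin n) (Fin m) Rᵐᵒᵖ := Matrix.of fun i j => op (Y j i.rev)
  let Y' : Matrix (Fin m) (Fin n) Rᵐᵒᵖ := Matrix.of fun k l => op (X l.rev k)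
  let A' : Matrix (Fin n) (Fin n) Rᵐᵒᵖ := oppositeMatrix A
  let B' : Matrix (Fin m) (Fin m) Rᵐᵒᵖ := Matrix.of fun k j => op (B j k)
  let C' : Matrix (Fin m) (Fin m) Sᵐᵒᵖ := Matrix.of fun k j => op (C j k)
  let ν' : Sᵐᵒᵖ →+ Rᵐᵒᵖ := opAddEquiv.toAddMonoidHom.comp (ν.comp opAddEquiv.symm.toAddMonoidHom)
  have hD : ∀ k j, (1 - op a • B'.map (RingHom.op ι)) k j = op ((1 - a • B.map ι) j k) := by
    intro k j
    have h1 : (1 : Matrix (Fin m) (Fin m) Sᵐᵒᵖ) k j = op ((1 : Matrix (Fin m) (Fin m) S) j k) := by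
      rw [Matrix.one_apply, Matrix.one_apply]
      by_cases h : k = j
      · simp [h]
      · simp [h, Ne.symm h]
    rw [Matrix.sub_apply, Matrix.sub_apply, h1, op_sub]
    congr 1
    exact congrArg op (ha (B j k)).symm.eq
  have hX' : IsRowPseudoComm X' := by
    refine ⟨fun i j k l => ?_, fun i j l => ?_⟩
    · simp only [X', Matrix.of_apply, Matrix.transpose_apply, op_lie]
      exact congrArg op (hY.1 _ _ _ _)
    · simp only [X', Matrix.of_apply, Matrix.transpose_apply, op_lie, hY.2, op_zero]
  -- Since `op` reverses commutators, `op c` plays the annihilation operator and `op a` the creation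
  -- operator, and the two vacuum conditions are exchanged.
  have main := sum_colDet_mul_colDet_eq_vev (ι := RingHom.op ι) (ν := ν') (a := op c) (c := op a)
    (X := X') (Y := Y') (A := A') (B := B') (C := C')
    (by rw [← op_mul, ← op_mul, ← op_sub, hac, op_one])
    (fun r => (hc r.unop).op) (fun r => (ha r.unop).op) (fun r => congrArg op (hν r.unop))
    (fun s => congrArg op (hνc s.unop)) (fun s => congrArg op (hνa s.unop))
    (by
      ext k j
      rw [Matrix.mul_apply]
      simp only [hD, C', Matrix.of_apply, ← op_mul, ← Finset.op_sum]
      rw [← Matrix.mul_apply, hDC]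
      simp only [Matrix.one_apply, apply_ite op, op_one, op_zero, eq_comm])
    (by
      ext k j
      rw [Matrix.mul_apply]
      simp only [hD, C', Matrix.of_apply, ← op_mul, ← Finset.op_sum]
      rw [← Matrix.mul_apply, hCD]
      simp only [Matrix.one_apply, apply_ite op, op_one, op_zero, eq_comm])
    (fun i j k l => by
      simp only [X', Y', A', B', oppositeMatrix_apply, Matrix.of_apply, op_lie, hXY,
        op_neg, ← op_mul]
      rw [Subring.mem_center_iff.1 (hB j k)])
    (fun i j => Subring.mem_center_iff.2 fun r => congrArg op
      (Subring.mem_center_iff.1 (hB j i) r.unop).symm)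
    hX'
    (fun i j k l => by
      simp only [X', A', oppositeMatrix_apply, Matrix.of_apply, op_lie, ← op_sub]
      have h := hYA j i.rev l.rev k.rev
      rw [Ring.lie_def, Ring.lie_def] at h ⊢
      rw [← op_zero, ← neg_zero, ← h]
      congr 1
      abel)
  have hM : op c • A'.map (RingHom.op ι) + X'.map (RingHom.op ι) * C' * Y'.map (RingHom.op ι) =
      oppositeMatrix (c • A.map ι + X.map ι * C * Y.map ι) := by
    ext i j
    rw [oppositeMatrix_apply, Matrix.add_apply, Matrix.add_apply, op_add]
    congr 1
    · exact congrArg op (hc _).symm.eq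
    · rw [Matrix.mul_assoc, Matrix.mul_apply, Matrix.mul_apply, Finset.op_sum]
      refine Finset.sum_congr rfl fun p _ => ?_
      rw [Matrix.mul_apply, Matrix.mul_apply, op_mul, Finset.op_sum]
      rfl
  rw [hM, colDet_oppositeMatrix] at main
  refine op_injective (Eq.trans ?_ main)
  rw [Finset.op_sum]
  refine Finset.sum_congr rfl fun L _ => ?_
  have h1 := colDet_oppositeMatrix (rowMinor Y L)
  have h2 := colDet_oppositeMatrix (colMinor X L)
  -- Index reversal permutes the columns of one minor and the rows of the other; the two equal signs
  -- cancel in the product.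
  have h1' := hX'.colDet_submatrix_perm (L.1.orderEmbOfFin L.2) Fin.revPerm
  have h2' := colDet_submatrix_perm_left (rowMinor Y' L) Fin.revPerm
  rw [op_mul, ← h1, ← h2]
  refine (congrArg₂ (· * ·) h1' h2').trans ?_
  rw [smul_mul_smul_comm, ← Units.val_mul, Int.units_mul_self, Units.val_one, one_smul]
  rfl

end Opposite

/-! ### Invertibility of `1 - a†B` and `1 - aB`. -/

section Invertibility

theorem Matrix.isUnit_of_bijective_mulVec {V κ : Type*} [AddCommGroup V] [Fintype κ] [DecidableEq κ]
    (D : Matrix κ κ (Module.End ℤ V)) (hinj : ∀ v : κ → V, (∀ i, ∑ j, D i j (v j) = 0) → v = 0)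
    (hsurj : ∀ w : κ → V, ∃ v : κ → V, ∀ i, ∑ j, D i j (v j) = w i) : IsUnit D := by
  let e := endVecRingEquivMatrixEnd κ ℤ V
  have he : ∀ v i, e.symm D v i = ∑ j, D i j (v j) := fun _ _ => rfl
  have h : IsUnit (e.symm D) := by
    rw [Module.End.isUnit_iff]
    refine ⟨(injective_iff_map_eq_zero _).2 fun v hv => hinj v fun i => ?_, fun w => ?_⟩
    · rw [← he, hv, Pi.zero_apply]
    · obtain ⟨v, hv⟩ := hsurj w
      exact ⟨v, funext fun i => (he v i).trans (hv i)⟩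
  simpa using h.map e

variable {R : Type*} [Ring R] {m : ℕ}

theorem sum_oneSub_apply {V : Type*} [AddCommGroup V] [Module R V] (q : Module.End ℤ V)
    (B : Matrix (Fin m) (Fin m) R) (v : Fin m → V) (i : Fin m) :
    ∑ j, oneSub q B i j (v j) = v i - ∑ j, q (B i j • v j) := by
  have h : ∀ j, oneSub q B i j (v j) = (if i = j then v j else 0) - q (B i j • v j) := fun j => by
    rw [oneSub, Matrix.sub_apply, LinearMap.sub_apply, Matrix.one_apply]
    congr 1
    split_ifs <;> rfl
  simp [h]

theorem isUnit_oneSub_formalCreate (B : Matrix (Fin m) (Fin m) R) :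
    IsUnit (oneSub (formalCreate R) B) := by
  refine Matrix.isUnit_of_bijective_mulVec _ (fun v hv => ?_) fun w => ?_
  · simp only [sum_oneSub_apply, sub_eq_zero] at hv
    have h : ∀ k i, v i k = 0 := by
      intro k
      induction k with
      | zero =>
        intro i
        rw [hv i, Finset.sum_apply]
        exact Finset.sum_eq_zero fun j _ => rfl
      | succ k ih =>
        intro i
        rw [hv i, Finset.sum_apply]
        refine Finset.sum_eq_zero fun j _ => ?_
        change B i j * v j k = 0
        rw [ih, mul_zero]
    exact funext fun i => funext fun k => h k i
  -- The coefficient of `|k+1⟩` in the equation involves the unknown only at levels `k+1` and `k`,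
  -- so it is solved by recursion.
  · let u : ℕ → Fin m → R := fun k => Nat.rec (fun i => w i 0)
      (fun k u i => w i (k + 1) + ∑ j, B i j * u j) k
    refine ⟨fun i k => u k i, fun i => ?_⟩
    rw [sum_oneSub_apply]
    funext k
    rw [Pi.sub_apply, Finset.sum_apply]
    cases k with
    | zero =>
      exact (congrArg _ (Finset.sum_eq_zero fun j _ => rfl)).trans (sub_zero _)
    | succ k => exact add_sub_cancel_right _ _

theorem finAnnihilate_apply (f : ℕ →₀ R) (k : ℕ) :
    finAnnihilate R f k = (k + 1) • f (k + 1) := by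
  induction f using Finsupp.induction_linear with
  | zero => simp
  | add f g hf hg => rw [map_add, Finsupp.add_apply, hf, hg, Finsupp.add_apply, smul_add]
  | single l r =>
    rw [finAnnihilate, Finsupp.lsum_single, LinearMap.smul_apply, Finsupp.lsingle_apply,
      Finsupp.smul_apply]
    rcases l with _ | l
    · simp
    · by_cases h : l = k <;> simp [h]

theorem finCreate_apply_zero (f : ℕ →₀ R) : finCreate R f 0 = 0 := by
  induction f using Finsupp.induction_linear with
  | zero => simp
  | add f g hf hg => rw [map_add, Finsupp.add_apply, hf, hg, add_zero]
  | single l r => simp [finCreate]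

theorem finCreate_apply_succ (f : ℕ →₀ R) (k : ℕ) : finCreate R f (k + 1) = f k := by
  induction f using Finsupp.induction_linear with
  | zero => simp
  | add f g hf hg => rw [(finCreate R).map_add, Finsupp.add_apply, hf, hg, Finsupp.add_apply]
  | single l r => simp [finCreate, Finsupp.single_apply]

theorem exists_bound_finsupp (v : Fin m → ℕ →₀ R) : ∃ K, ∀ i k, K ≤ k → v i k = 0 := by
  refine ⟨Finset.univ.sup fun i => (v i).support.sup id + 1, fun i k hk => ?_⟩
  by_contra h
  have h1 : k ≤ (v i).support.sup id :=
    Finset.le_sup (f := id) (Finsupp.mem_support_iff.2 h)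
  have h2 := Finset.le_sup (f := fun i => (v i).support.sup id + 1) (Finset.mem_univ i)
  omega

theorem isUnit_oneSub_finAnnihilate (B : Matrix (Fin m) (Fin m) R) :
    IsUnit (oneSub (finAnnihilate R) B) := by
  have happ : ∀ (v : Fin m → ℕ →₀ R) i k, (∑ j, finAnnihilate R (B i j • v j)) k =
      ∑ j, (k + 1) • (B i j * v j (k + 1)) := fun v i k => by
    rw [Finsupp.finsetSum_apply]
    exact Finset.sum_congr rfl fun j _ => finAnnihilate_apply _ _
  refine Matrix.isUnit_of_bijective_mulVec _ (fun v hv => ?_) fun w => ?_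
  · simp only [sum_oneSub_apply, sub_eq_zero] at hv
    obtain ⟨K, hK⟩ := exists_bound_finsupp v
    have h : ∀ d i k, K ≤ k + d → v i k = 0 := by
      intro d
      induction d with
      | zero => exact hK
      | succ d ih =>
        intro i k hk
        rw [hv i, happ]
        refine Finset.sum_eq_zero fun j _ => ?_
        rw [ih j (k + 1) (by omega), mul_zero, smul_zero]
    exact funext fun i => Finsupp.ext fun k => h K i k (by omega)
  · obtain ⟨K, hK⟩ := exists_bound_finsupp w
    simp only [sum_oneSub_apply]
    -- The Neumann series terminates: each application of `aB` lowers the bound on the occupied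
    -- levels by one.
    induction K generalizing w with
    | zero =>
      refine ⟨0, fun i => ?_⟩
      ext k
      simp [hK i k]
    | succ K ih =>
      obtain ⟨v, hv⟩ := ih (fun i => ∑ j, finAnnihilate R (B i j • w j)) fun i k hk => by
        rw [happ]
        refine Finset.sum_eq_zero fun j _ => ?_
        rw [hK j (k + 1) (by omega), mul_zero, smul_zero]
      refine ⟨w + v, fun i => ?_⟩
      simp only [Pi.add_apply, smul_add, map_add, Finset.sum_add_distrib]
      rw [← hv i]
      abel

end Invertibility

/-! ### Determinants independent of the order of the factors. -/

section HasDet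

variable {S : Type*} [Ring S] {n m : ℕ} {M : Matrix (Fin n) (Fin n) S} {d : S}

theorem HasDet.colDet_eq (h : HasDet M d) : colDet M = d := h fun _ => 1

theorem HasDet.rowDet_eq (h : HasDet M d) : rowDet M = d := by
  -- The order `σ⁻¹` lists the factors of the term `σ` by increasing row index.
  rw [← h fun σ => σ⁻¹, rowDet, ← Equiv.sum_comp (Equiv.inv (Equiv.Perm (Fin n)))]
  refine Finset.sum_congr rfl fun σ _ => ?_
  simp

theorem hasDet_colDet_of_commute
    (h : ∀ i j k l, i ≠ k → j ≠ l → Commute (M i j) (M k l)) : HasDet M (colDet M) := by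
  intro τ
  refine Finset.sum_congr rfl fun σ _ => ?_
  congr 1
  refine List.Perm.prod_eq' ((τ σ).ofFn_comp_perm fun i => M (σ i) i) ?_
  rw [List.pairwise_ofFn]
  intro i j hij
  have hne : τ σ i ≠ τ σ j := (τ σ).injective.ne hij.ne
  exact h _ _ _ _ (σ.injective.ne hne) hne

theorem isRowPseudoComm_of_commute {X : Matrix (Fin n) (Fin m) S}
    (h : ∀ i j k l, j ≠ l → ⁅X j i, X l k⁆ = 0) : IsRowPseudoComm X := by
  have h' : ∀ i j k l, ⁅X j i, X l k⁆ = ⁅X l i, X j k⁆ := fun i j k l => by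
    by_cases hjl : j = l
    · rw [hjl]
    · rw [h _ _ _ _ hjl, h _ _ _ _ (Ne.symm hjl)]
  refine ⟨h', fun i j l => ?_⟩
  rw [Matrix.transpose_apply, Matrix.transpose_apply]
  by_cases hjl : j = l
  · rw [hjl, Ring.lie_def, sub_self]
  · exact h _ _ _ _ hjl

theorem isColPseudoComm_of_commute {Y : Matrix (Fin m) (Fin n) S}
    (h : ∀ i j k l, j ≠ l → ⁅Y i j, Y k l⁆ = 0) : IsColPseudoComm Y :=
  isRowPseudoComm_of_commute (X := Y.transpose) h

end HasDet

/-! ### The two concrete Fock spaces. -/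

section Fock

variable {R : Type*} [Ring R] {n m : ℕ}
  {X : Matrix (Fin n) (Fin m) R} {Y : Matrix (Fin m) (Fin n) R}
  {A : Matrix (Fin n) (Fin n) R} {B : Matrix (Fin m) (Fin m) R}

theorem sum_colDet_mul_colDet_eq_formalVev
    (hXY : ∀ i j k l, ⁅X i j, Y k l⁆ = -(A i l * B k j))
    (hB : ∀ i j, B i j ∈ Subring.center R) (hX : IsRowPseudoComm X)
    (hXA : ∀ i j k l, ⁅X i j, A k l⁆ - ⁅X k j, A i l⁆ = 0) :
    ∑ L : Subsets m n, colDet (colMinor X L) * colDet (rowMinor Y L) =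
      formalVev (colDet (oscMatrix (formalAnnihilate R) (formalCreate R) X Y A B)) := by
  have hu := isUnit_oneSub_formalCreate B
  let ν : Module.End ℤ (ℕ → R) →+ R :=
    { toFun := formalVev, map_zero' := rfl, map_add' := fun _ _ => rfl }
  refine sum_colDet_mul_colDet_eq_vev (ι := Module.toModuleEnd ℤ (ℕ → R)) (ν := ν)
    (a := formalAnnihilate R) (c := formalCreate R) (C := Ring.inverse (oneSub (formalCreate R) B))
    ?_ (fun r => ?_) (fun r => ?_) (fun r => ?_) (fun s => ?_) (fun s => rfl)
    (Ring.inverse_mul_cancel _ hu) (Ring.mul_inverse_cancel _ hu) hXY hB hX hXA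
  · refine LinearMap.ext fun f => funext fun k => ?_
    change (k + 1) • f k - formalCreate R (formalAnnihilate R f) k = f k
    cases k with
    | zero =>
      change (0 + 1) • f 0 - 0 = f 0
      simp
    | succ k =>
      change (k + 1 + 1) • f (k + 1) - (k + 1) • f (k + 1) = f (k + 1)
      rw [succ_nsmul, add_sub_cancel_left]
  · refine LinearMap.ext fun f => funext fun k => ?_
    exact (mul_smul_comm (k + 1) r (f (k + 1))).symm
  · refine LinearMap.ext fun f => funext fun k => ?_
    cases k with
    | zero => exact (mul_zero r).symm
    | succ k => rfl
  · change r * Pi.single (M := fun _ => R) 0 1 0 = r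
    simp
  · have h : formalAnnihilate R (Pi.single 0 1) = 0 := funext fun k => by
      change (k + 1) • Pi.single (M := fun _ => R) 0 1 (k + 1) = 0
      simp
    change s (formalAnnihilate R (Pi.single 0 1)) 0 = 0
    rw [h, map_zero, Pi.zero_apply]

theorem sum_rowDet_mul_rowDet_eq_finVev
    (hXY : ∀ i j k l, ⁅X i j, Y k l⁆ = -(A i l * B k j))
    (hB : ∀ i j, B i j ∈ Subring.center R) (hY : IsColPseudoComm Y)
    (hYA : ∀ i j k l, ⁅Y i j, A k l⁆ - ⁅Y i l, A k j⁆ = 0) :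
    ∑ L : Subsets m n, rowDet (colMinor X L) * rowDet (rowMinor Y L) =
      finVev (rowDet (oscMatrix (finCreate R) (finAnnihilate R) X Y A B)) := by
  have hu := isUnit_oneSub_finAnnihilate B
  let ν : Module.End ℤ (ℕ →₀ R) →+ R :=
    { toFun := finVev, map_zero' := rfl, map_add' := fun _ _ => rfl }
  refine sum_rowDet_mul_rowDet_eq_vev (ι := Module.toModuleEnd ℤ (ℕ →₀ R)) (ν := ν)
    (a := finAnnihilate R) (c := finCreate R) (C := Ring.inverse (oneSub (finAnnihilate R) B))
    ?_ (fun r => ?_) (fun r => ?_) (fun r => ?_) (fun s => ?_) (fun s => finCreate_apply_zero _)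
    (Ring.inverse_mul_cancel _ hu) (Ring.mul_inverse_cancel _ hu) hXY hB hY hYA
  · refine LinearMap.ext fun f => Finsupp.ext fun k => ?_
    change finAnnihilate R (finCreate R f) k - finCreate R (finAnnihilate R f) k = f k
    rw [finAnnihilate_apply, finCreate_apply_succ]
    cases k with
    | zero => rw [finCreate_apply_zero, zero_add, one_smul, sub_zero]
    | succ k => rw [finCreate_apply_succ, finAnnihilate_apply, succ_nsmul, add_sub_cancel_left]
  · refine LinearMap.ext fun f => Finsupp.ext fun k => ?_
    change finAnnihilate R (r • f) k = r * finAnnihilate R f k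
    rw [finAnnihilate_apply, finAnnihilate_apply, mul_smul_comm]
    rfl
  · refine LinearMap.ext fun f => Finsupp.ext fun k => ?_
    change finCreate R (r • f) k = r * finCreate R f k
    cases k with
    | zero => rw [finCreate_apply_zero, finCreate_apply_zero, mul_zero]
    | succ k =>
      rw [finCreate_apply_succ, finCreate_apply_succ]
      rfl
  · change r * Finsupp.single 0 (1 : R) 0 = r
    simp
  · have h : finAnnihilate R (Finsupp.single 0 1) = 0 := Finsupp.ext fun k => by
      rw [finAnnihilate_apply]
      simp
    change s (finAnnihilate R (Finsupp.single 0 1)) 0 = 0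
    rw [h, s.map_zero, Finsupp.zero_apply]

end Fock

theorem proposition1p2 {R : Type*} [Ring R] {n m : ℕ}
    (X : Matrix (Fin n) (Fin m) R) (Y : Matrix (Fin m) (Fin n) R)
    (A : Matrix (Fin n) (Fin n) R) (B : Matrix (Fin m) (Fin m) R)
    (hXY : ∀ i j k l, ⁅X i j, Y k l⁆ = -(A i l * B k j))
    (hB : ∀ i j, B i j ∈ Subring.center R) :
    -- the inverses below exist in the matrix rings over the operators
    (IsUnit (oneSub (formalCreate R) B) ∧ IsUnit (oneSub (finAnnihilate R) B)) ∧
    -- (a)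
    (IsRowPseudoComm X → (∀ i j k l, ⁅X i j, A k l⁆ - ⁅X k j, A i l⁆ = 0) →
      ∑ L : Subsets m n, colDet (colMinor X L) * colDet (rowMinor Y L) =
        formalVev (colDet (oscMatrix (formalAnnihilate R) (formalCreate R) X Y A B))) ∧
    -- (b)
    (IsColPseudoComm Y → (∀ i j k l, ⁅Y i j, A k l⁆ - ⁅Y i l, A k j⁆ = 0) →
      ∑ L : Subsets m n, rowDet (colMinor X L) * rowDet (rowMinor Y L) =
        finVev (rowDet (oscMatrix (finCreate R) (finAnnihilate R) X Y A B))) ∧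
    -- (c)
    ((∀ i j k l, j ≠ l → ⁅X j i, X l k⁆ = 0) → (∀ i j k l, j ≠ l → ⁅Y i j, Y k l⁆ = 0) →
      ∃ detX detY : Subsets m n → R,
        (∀ L, HasDet (colMinor X L) (detX L)) ∧ (∀ L, HasDet (rowMinor Y L) (detY L)) ∧
        ((∀ i j k l, ⁅X i j, A k l⁆ - ⁅X k j, A i l⁆ = 0) →
          ∑ L : Subsets m n, detX L * detY L =
            formalVev (colDet (oscMatrix (formalAnnihilate R) (formalCreate R) X Y A B))) ∧
        ((∀ i j k l, ⁅Y i j, A k l⁆ - ⁅Y i l, A k j⁆ = 0) →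
          ∑ L : Subsets m n, detX L * detY L =
            finVev (rowDet (oscMatrix (finCreate R) (finAnnihilate R) X Y A B)))) := by
  refine ⟨⟨isUnit_oneSub_formalCreate B, isUnit_oneSub_finAnnihilate B⟩,
    sum_colDet_mul_colDet_eq_formalVev hXY hB, sum_rowDet_mul_rowDet_eq_finVev hXY hB,
    fun hX hY => ⟨fun L => colDet (colMinor X L), fun L => colDet (rowMinor Y L), ?_⟩⟩
  have hdX : ∀ L : Subsets m n, HasDet (colMinor X L) (colDet (colMinor X L)) := fun L =>
    hasDet_colDet_of_commute fun i j k l hik _ => sub_eq_zero.1 (hX _ i _ k hik)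
  have hdY : ∀ L : Subsets m n, HasDet (rowMinor Y L) (colDet (rowMinor Y L)) := fun L =>
    hasDet_colDet_of_commute fun i j k l _ hjl => sub_eq_zero.1 (hY _ j _ l hjl)
  refine ⟨hdX, hdY, sum_colDet_mul_colDet_eq_formalVev hXY hB (isRowPseudoComm_of_commute hX),
    fun hYA => ?_⟩
  rw [← sum_rowDet_mul_rowDet_eq_finVev hXY hB (isColPseudoComm_of_commute hY) hYA]
  exact Finset.sum_congr rfl fun L _ => by rw [(hdX L).rowDet_eq, (hdY L).rowDet_eq]
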